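/- Theorem 4. Let $\mathcal T$ be an unweighted tree on $n\ge 5$ nodes (a finite simple connected graph without cycles, all edge weights equal to $1$), let $L_{\mathcal T}$ be its Laplacian matrix, with eigenvalues $0=\lambda_1<\lambda_2\le\dots\le\lambda_n$, and let $M_n=I_n-\frac1n J_n$, where $J_n$ is the $n\times n$ all-ones matrix. Consider the first-order consensus network $$\dot x=-L_{\mathcal T}\,x+\xi,\qquad y=Cx,\qquad C^{\mathsf T}C=M_n,$$ where $\xi$ is an uncorrelated white noise process with zero mean and identity covariance and the initial state $x(0)$ is square-integrable. Then the steady-state variance of the output exists and is given by $$\boldsymbol\rho_{ss}(L_{\mathcal T};M_n):=\lim_{t\to\infty}\mathbb E\big[y(t)^{\mathsf T}y(t)\big]=\frac12\sum_{i=2}^{n}\lambda_i^{-1},$$ and it satisfies $$\frac{(n-1)^2}{2n}\;\le\;\boldsymbol\rho_{ss}(L_{\mathcal T};M_n)\;\le\;\frac{n^2-1}{12}.$$ Moreover, the lower bound is attained if and only if $\mathcal T$ is the star graph $\mathcal S_n$, and the upper bound is attained if and only if $\mathcal T$ is the path graph $\mathcal P_n$ (up to isomorphism). -/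

import Mathlib

open MeasureTheory Filter Topology
open scoped Matrix

namespace ConsensusNetwork

/-- The centering matrix `M_n = I - (1/n) J`, with `n` the number of nodes. -/
noncomputable def centeringMatrix (V : Type*) [Fintype V] [DecidableEq V] : Matrix V V ℝ :=
  1 - (Fintype.card V : ℝ)⁻¹ • Matrix.of (fun _ _ => (1 : ℝ))

/-- `W` is the time integral `W t = ∫₀ᵗ ξ` of a white noise `ξ` with zero mean and identity
covariance, uncorrelated in time and across the nodes: a jointly measurable, square-integrable
process with `E (W i t) = 0` and `E (W i s * W j t) = δ i j * min s t` for all `s, t ≥ 0`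
(for instance, a standard Brownian motion). Only the times `t ≥ 0` matter. -/
structure IsIntegratedWhiteNoise {Ω V : Type*} [MeasurableSpace Ω] [Fintype V] [DecidableEq V]
    (P : Measure Ω) (W : ℝ → Ω → V → ℝ) : Prop where
  measurable : ∀ i, Measurable (fun p : ℝ × Ω => W p.1 p.2 i)
  memLp : ∀ t, 0 ≤ t → ∀ i, MemLp (fun ω => W t ω i) 2 P
  mean : ∀ t, 0 ≤ t → ∀ i, ∫ ω, W t ω i ∂P = 0
  covariance : ∀ s t, 0 ≤ s → 0 ≤ t → ∀ i j,
    ∫ ω, W s ω i * W t ω j ∂P = if i = j then min s t else 0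

/-- `x` is a state trajectory of the first-order network `x' = - A x + ξ` started at time `0` from
a square-integrable initial state, where `W` is the time integral of the noise `ξ`. Since the noise
is additive, the equation is read path by path, in integrated form. -/
structure IsStateTrajectory {Ω V : Type*} [MeasurableSpace Ω] [Fintype V]
    (P : Measure Ω) (A : Matrix V V ℝ) (W x : ℝ → Ω → V → ℝ) : Prop where
  memLp_initial : ∀ i, MemLp (fun ω => x 0 ω i) 2 P
  intervalIntegrable : ∀ᵐ ω ∂P, ∀ t, 0 ≤ t → ∀ i,
    IntervalIntegrable (fun s => x s ω i) volume 0 t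
  integral_eq : ∀ᵐ ω ∂P, ∀ t, 0 ≤ t → ∀ i,
    x t ω i = x 0 ω i - (∫ s in (0 : ℝ)..t, (A *ᵥ x s ω) i) + W t ω i

/-- `ρ` is the steady-state variance `lim_{t → ∞} E [y(t)ᵀ y(t)]` of the output process `y`; the
expectations are required to be finite and the limit to exist. -/
def HasSteadyStateVariance {Ω U : Type*} [MeasurableSpace Ω] [Fintype U]
    (P : Measure Ω) (y : ℝ → Ω → U → ℝ) (ρ : ℝ) : Prop :=
  (∀ t, 0 ≤ t → Integrable (fun ω => y t ω ⬝ᵥ y t ω) P) ∧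
    Tendsto (fun t => ∫ ω, y t ω ⬝ᵥ y t ω ∂P) atTop (𝓝 ρ)

/-- Half the sum of the reciprocals of the nonzero eigenvalues, counted with multiplicity, of the
Laplacian matrix of an unweighted graph. -/
noncomputable def rhoSS {V : Type*} [Fintype V] [DecidableEq V] (G : SimpleGraph V)
    [DecidableRel G.Adj] : ℝ :=
  (1 / 2) * ∑ i with (G.isHermitian_lapMatrix (R := ℝ)).eigenvalues i ≠ 0,
    ((G.isHermitian_lapMatrix (R := ℝ)).eigenvalues i)⁻¹

end ConsensusNetwork

/-!
The output sees exactly the modes of the Laplacian `L` with nonzero eigenvalue, since `Cᵀ C` is the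
projection along the constants, which span the kernel of `L` for a connected graph. The component
`z` of the state along a unit eigenvector for `λ > 0` solves the scalar equation `z' = -λ z + B'`
with `B` of covariance `min s t`. Variation of constants (`eq_of_integral_equation`) and an Itô
isometry that uses second moments only (`integral_stochasticConvolution_sq`) show that `E z(t)²`
tends to `1 / (2 λ)`, whatever the correlation between the initial state and the noise
(`tendsto_integral_mode_sq`). Summing over the modes gives
`ConsensusNetwork.hasSteadyStateVariance_rhoSS`.

The bounds are statements about the total distance `S = ∑ u, ∑ v, dist u v`, because
`rhoSS T = S / (4 n)` for a tree (`SimpleGraph.IsTree.rhoSS_eq`). Indeed a tree has exactly one edge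
at `v` leading towards `u ≠ v`, so its distance matrix `D` satisfies `L D = (2 - deg) 1ᵀ - 2 I`
(`SimpleGraph.IsTree.lapMatrix_mulVec_dist`). Hence `eᵀ D e = -2 / λ` for a unit eigenvector `e` with
`λ ≠ 0`, while the unit constant vector contributes `S / n` to the trace of `D`, which is `0`.

* Lower bound: all pairs are at distance at least `2` except for the `n - 1` edges and the diagonal.
  Equality means that the diameter is at most `2`, and such a tree is a star
  (`SimpleGraph.IsTree.two_mul_sq_eq_sum_dist_iff`).
* Upper bound: in a connected graph the distances from a vertex sum to at most `n (n - 1) / 2`, since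
  no distance is skipped; removing non-cut vertices one at a time bounds `S` by `n (n² - 1) / 3`
  (`SimpleGraph.Connected.three_mul_sum_dist_le`). Equality forces a vertex from which each of the
  distances `0, …, n - 1` occurs, and then the tree is a path
  (`SimpleGraph.IsTree.three_mul_sum_dist_eq_iff`).
-/

/-! ### Distances in connected graphs and trees -/

namespace SimpleGraph

variable {V : Type*} {G : SimpleGraph V}

lemma Connected.exists_adj_dist_eq_add_one (hG : G.Connected) {u v : V} (h : u ≠ v) :
    ∃ w, G.Adj v w ∧ G.dist u v = G.dist u w + 1 := by
  obtain ⟨p, hp⟩ := hG.exists_walk_length_eq_dist v u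
  cases p with
  | nil => exact absurd rfl h
  | @cons _ w _ hadj q =>
    refine ⟨w, hadj, ?_⟩
    have h1 := dist_le q
    have h2 : G.dist v u ≤ G.dist v w + G.dist w u := hG.dist_triangle
    rw [dist_eq_one_iff_adj.mpr hadj] at h2
    rw [Walk.length_cons] at hp
    rw [dist_comm (u := u) (v := v), dist_comm (u := u) (v := w)]
    omega

/-- In a tree, only one neighbour of `v` lies on the way from `v` to `u`: shortest walks are paths,
and paths are unique. -/
lemma IsTree.eq_of_adj_of_dist_eq_add_one (hG : G.IsTree) {u v w w' : V}
    (hw : G.Adj v w) (hd : G.dist u v = G.dist u w + 1)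
    (hw' : G.Adj v w') (hd' : G.dist u v = G.dist u w' + 1) : w = w' := by
  obtain ⟨q, hq⟩ := hG.connected.exists_walk_length_eq_dist w u
  obtain ⟨q', hq'⟩ := hG.connected.exists_walk_length_eq_dist w' u
  have h1 : (Walk.cons hw q).IsPath := by
    apply Walk.isPath_of_length_eq_dist
    rw [Walk.length_cons, hq, dist_comm (u := v), dist_comm (u := w), hd]
  have h2 : (Walk.cons hw' q').IsPath := by
    apply Walk.isPath_of_length_eq_dist
    rw [Walk.length_cons, hq', dist_comm (u := v), dist_comm (u := w'), hd']
  have := congrArg Walk.snd ((hG.existsUnique_path v u).unique h1 h2)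
  simpa using this

lemma Connected.exists_dist_eq_of_le (hG : G.Connected) {v u : V} {k : ℕ} (h : k ≤ G.dist v u) :
    ∃ w, G.dist v w = k := by
  induction hd : G.dist v u - k generalizing u with
  | zero => exact ⟨u, by omega⟩
  | succ m ih =>
    have hne : v ≠ u := by
      rintro rfl
      simp at hd
    obtain ⟨w, -, hw⟩ := hG.exists_adj_dist_eq_add_one hne
    exact ih (u := w) (by omega) (by omega)

/-! ### Transmissions and the upper bound on the total distance -/

variable [Fintype V]

lemma Connected.dist_lt_card (hG : G.Connected) (u v : V) : G.dist u v < Fintype.card V := by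
  obtain ⟨p, hp, hl⟩ := hG.exists_path_of_dist u v
  exact hl ▸ hp.length_lt

/-- Each of the `k + 1` distances `0, …, k` is attained as soon as some vertex is farther than `k`
from `v`. -/
lemma Connected.card_lt_dist_le (hG : G.Connected) (v : V) (k : ℕ) :
    (Finset.univ.filter fun u => k < G.dist v u).card ≤ Fintype.card V - 1 - k := by
  classical
  rcases (Finset.univ.filter fun u => k < G.dist v u).eq_empty_or_nonempty with h | ⟨u, hu⟩
  · simp [h]
  · have hu : k < G.dist v u := by simpa using hu
    have h1 : Finset.range (k + 1) ⊆
        (Finset.univ.filter fun u => ¬ k < G.dist v u).image (G.dist v) := by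
      intro j hj
      have hj : j < k + 1 := by simpa using hj
      obtain ⟨w, hw⟩ := hG.exists_dist_eq_of_le (v := v) (u := u) (k := j) (by omega)
      exact Finset.mem_image.mpr ⟨w, by simp; omega, hw⟩
    have h2 := (Finset.card_le_card h1).trans Finset.card_image_le
    rw [Finset.card_range] at h2
    have h3 := Finset.card_filter_add_card_filter_not (s := (Finset.univ : Finset V))
      (fun u => k < G.dist v u)
    rw [Finset.card_univ] at h3
    omega

lemma Connected.sum_dist_eq_sum_card (hG : G.Connected) (v : V) :
    ∑ u, G.dist v u =
      ∑ k ∈ Finset.range (Fintype.card V), (Finset.univ.filter fun u => k < G.dist v u).card := by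
  simp_rw [Finset.card_filter]
  rw [Finset.sum_comm]
  refine Finset.sum_congr rfl fun u _ => ?_
  rw [← Finset.card_filter]
  have : (Finset.range (Fintype.card V)).filter (fun k => k < G.dist v u) =
      Finset.range (G.dist v u) := by
    ext k
    have := hG.dist_lt_card v u
    simp
    omega
  rw [this, Finset.card_range]

lemma two_mul_sum_range_sub (n : ℕ) : 2 * ∑ k ∈ Finset.range n, (n - 1 - k) = n * (n - 1) := by
  rw [Finset.sum_range_reflect (fun k => k) n, mul_comm, Finset.sum_range_id_mul_two]

lemma Connected.two_mul_sum_dist_le (hG : G.Connected) (v : V) :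
    2 * ∑ u, G.dist v u ≤ Fintype.card V * (Fintype.card V - 1) := by
  rw [← two_mul_sum_range_sub, hG.sum_dist_eq_sum_card]
  exact Nat.mul_le_mul_left _ (Finset.sum_le_sum fun k _ => hG.card_lt_dist_le v k)

/-- A vertex of extremal transmission sees every possible distance `0, …, |V| - 1`. -/
lemma Connected.exists_dist_eq_of_two_mul_sum_dist_eq (hG : G.Connected) {v : V}
    (h : 2 * ∑ u, G.dist v u = Fintype.card V * (Fintype.card V - 1)) {k : ℕ}
    (hk : k < Fintype.card V) : ∃ u, G.dist v u = k := by
  rw [← two_mul_sum_range_sub, hG.sum_dist_eq_sum_card] at h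
  have h1 := (Finset.sum_eq_sum_iff_of_le (fun k _ => hG.card_lt_dist_le v k)).mp
    (Nat.eq_of_mul_eq_mul_left two_pos h)
  rcases k with - | k
  · exact ⟨v, by simp⟩
  · have h2 := h1 k (by simp; omega)
    have h3 : 0 < (Finset.univ.filter fun u => k < G.dist v u).card := by omega
    obtain ⟨u, hu⟩ := Finset.card_pos.mp h3
    have hu : k < G.dist v u := by simpa using hu
    exact hG.exists_dist_eq_of_le (u := u) hu

/-- Splitting off a vertex `v` that is not a cut vertex: distances can only grow in the
remaining graph. -/
lemma sum_dist_le_of_connected_induce [DecidableEq V] (v : V)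
    (hG : (G.induce {v}ᶜ).Connected) :
    ∑ a, ∑ b, G.dist a b ≤ 2 * ∑ b, G.dist v b +
      ∑ a : ({v}ᶜ : Set V), ∑ b : ({v}ᶜ : Set V), (G.induce {v}ᶜ).dist a b := by
  have split (f : V → ℕ) : ∑ a, f a = f v + ∑ a : ({v}ᶜ : Set V), f a := by
    rw [Fintype.sum_eq_add_sum_compl v]
    congr 1
    exact (Finset.sum_subtype _ (by simp) f)
  have hd (a b : ({v}ᶜ : Set V)) : G.dist a b ≤ (G.induce {v}ᶜ).dist a b := by
    obtain ⟨p, hp⟩ := hG.exists_walk_length_eq_dist a b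
    rw [← hp, ← Walk.length_map (Embedding.induce ({v}ᶜ : Set V)).toHom p]
    exact dist_le _
  have h1 : ∑ a, G.dist a v = ∑ b, G.dist v b :=
    Finset.sum_congr rfl fun a _ => dist_comm
  have h2 := split fun a => G.dist a v
  have h3 := split fun a => ∑ b, G.dist a b
  have h4 : ∑ a : ({v}ᶜ : Set V), ∑ b, G.dist a b = ∑ a : ({v}ᶜ : Set V), G.dist a v +
      ∑ a : ({v}ᶜ : Set V), ∑ b : ({v}ᶜ : Set V), G.dist a b := by
    rw [← Finset.sum_add_distrib]
    exact Finset.sum_congr rfl fun a _ => split fun b => G.dist a b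
  have h5 : ∑ a : ({v}ᶜ : Set V), ∑ b : ({v}ᶜ : Set V), G.dist a b ≤
      ∑ a : ({v}ᶜ : Set V), ∑ b : ({v}ᶜ : Set V), (G.induce {v}ᶜ).dist a b :=
    Finset.sum_le_sum fun a _ => Finset.sum_le_sum fun b _ => hd a b
  simp only [dist_self, zero_add] at h2
  omega

/-- The total distance of a connected graph on `n` vertices is at most that of the path, and a
graph attaining the bound has a vertex whose transmission is that of an end of the path. -/
theorem Connected.three_mul_sum_dist_le (hG : G.Connected) :
    3 * ∑ a, ∑ b, G.dist a b + Fintype.card V ≤ Fintype.card V ^ 3 ∧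
      (3 * ∑ a, ∑ b, G.dist a b + Fintype.card V = Fintype.card V ^ 3 →
        ∃ v, 2 * ∑ u, G.dist v u = Fintype.card V * (Fintype.card V - 1)) := by
  classical
  induction hn : Fintype.card V generalizing V with
  | zero =>
    have := hG.nonempty
    exact absurd hn Fintype.card_ne_zero
  | succ n ih =>
    rcases subsingleton_or_nontrivial V with hV | hV
    · have h0 : ∀ a b : V, G.dist a b = 0 := fun a b => by rw [Subsingleton.elim a b, dist_self]
      have h1 := Fintype.card_le_one_iff_subsingleton.mpr hV
      have hn0 : n = 0 := by omega
      obtain ⟨v⟩ := hG.nonempty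
      simp [h0, hn0]
      exact ⟨v⟩
    · obtain ⟨v, hv⟩ := hG.exists_connected_induce_compl_singleton_of_finite_nontrivial
      have hc : Fintype.card ({v}ᶜ : Set V) = n := by
        rw [Fintype.card_compl_set]
        simp [hn]
      have h1 := (ih hv hc).1
      have h2 := hG.two_mul_sum_dist_le v
      have h3 := sum_dist_le_of_connected_induce v hv
      rw [hn] at h2
      have h4 : (n + 1) ^ 3 = n ^ 3 + 3 * ((n + 1) * n) + 1 := by ring
      simp only [Nat.add_sub_cancel] at h2 ⊢
      exact ⟨by omega, fun h => ⟨v, by omega⟩⟩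

/-! ### Paths maximize the total distance -/

/-- If every distance occurs from `v`, the distance from `v` is a numbering of the tree along a
path. -/
lemma IsTree.nonempty_iso_pathGraph (hG : G.IsTree) {n : ℕ} (hn : Fintype.card V = n) {v : V}
    (h : ∀ k < n, ∃ u, G.dist v u = k) : Nonempty (G ≃g pathGraph n) := by
  have hlt (u : V) : G.dist v u < n := hn ▸ hG.connected.dist_lt_card v u
  let f : V → Fin n := fun u => ⟨G.dist v u, hlt u⟩
  have hf : f.Bijective := by
    rw [Fintype.bijective_iff_surjective_and_card]
    refine ⟨fun k => ?_, by simp [hn]⟩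
    obtain ⟨u, hu⟩ := h k k.2
    exact ⟨u, Fin.ext hu⟩
  have key {a b : V} (hab : G.dist v b = G.dist v a + 1) : G.Adj b a := by
    have hne : v ≠ b := by
      rintro rfl
      simp at hab
    obtain ⟨c, hc, hd⟩ := hG.connected.exists_adj_dist_eq_add_one hne
    have : c = a := hf.1 (Fin.ext (by simp only [f]; omega))
    exact this ▸ hc
  refine ⟨⟨Equiv.ofBijective f hf, fun {a b} => ?_⟩⟩
  rw [pathGraph_adj]
  simp only [Equiv.ofBijective_apply, f]
  constructor
  · rintro (h | h)
    · exact (key h.symm).symm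
    · exact key h.symm
  · intro hab
    rcases hG.dist_eq_dist_add_one_of_adj v hab with h | h
    · exact Or.inr h.symm
    · exact Or.inl h.symm

omit [Fintype V] in
lemma Connected.abs_sub_le_dist (hG : G.Connected) {f : V → ℤ}
    (hf : ∀ a b, G.Adj a b → |f a - f b| ≤ 1) (a b : V) : |f a - f b| ≤ G.dist a b := by
  obtain ⟨p, hp⟩ := hG.exists_walk_length_eq_dist a b
  rw [← hp]
  clear hp
  induction p with
  | nil => simp
  | @cons a c b hadj q ih =>
    rw [Walk.length_cons]
    have := abs_sub_le (f a) (f c) (f b)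
    have := hf a c hadj
    push_cast
    linarith

lemma three_mul_sum_abs_sub (n : ℕ) :
    3 * ∑ i : Fin n, ∑ j : Fin n, |(i : ℤ) - j| + n = (n : ℤ) ^ 3 := by
  induction n with
  | zero => simp
  | succ n ih =>
    have h1 (i : Fin n) : |((n : ℕ) : ℤ) - (i : ℕ)| = n - (i : ℕ) :=
      abs_of_nonneg (by have := i.2; omega)
    have h2 (i : Fin n) : |((i : ℕ) : ℤ) - (n : ℕ)| = n - (i : ℕ) := by rw [abs_sub_comm, h1]
    have h3 : 2 * ∑ i : Fin n, ((i : ℕ) : ℤ) = n * (n - 1) := by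
      rw [Fin.sum_univ_eq_sum_range (fun i => (i : ℤ)) n]
      clear ih h1 h2
      induction n with
      | zero => simp
      | succ n ih => rw [Finset.sum_range_succ, mul_add, ih]; push_cast; ring
    simp only [Fin.sum_univ_castSucc, Fin.val_castSucc, Fin.val_last, h1, h2,
      Finset.sum_add_distrib, Finset.sum_sub_distrib, Finset.sum_const, Finset.card_univ,
      Fintype.card_fin, nsmul_eq_mul, sub_self, abs_zero]
    push_cast
    linarith

/-- Along an isomorphism with the path, positions are `1`-Lipschitz, so that distances are at least
those of the path. -/
lemma Connected.le_three_mul_sum_dist_of_iso (hG : G.Connected) {n : ℕ}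
    (e : G ≃g pathGraph n) : n ^ 3 ≤ 3 * ∑ a, ∑ b, G.dist a b + n := by
  have h1 (a b : V) : |((e a : ℕ) : ℤ) - (e b : ℕ)| ≤ G.dist a b := by
    refine hG.abs_sub_le_dist (f := fun a => ((e a : ℕ) : ℤ)) (fun a b hab => ?_) a b
    have := pathGraph_adj.mp (e.map_adj_iff.mpr hab)
    rw [abs_le]
    omega
  have h2 : ∑ a, ∑ b, |((e a : ℕ) : ℤ) - (e b : ℕ)| = ∑ i : Fin n, ∑ j : Fin n, |(i : ℤ) - j| := by
    rw [← e.toEquiv.sum_comp]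
    refine Finset.sum_congr rfl fun a _ => ?_
    rw [← e.toEquiv.sum_comp]
    rfl
  have h3 : ∑ a, ∑ b, |((e a : ℕ) : ℤ) - (e b : ℕ)| ≤ ∑ a, ∑ b, (G.dist a b : ℤ) :=
    Finset.sum_le_sum fun a _ => Finset.sum_le_sum fun b _ => h1 a b
  have h4 := three_mul_sum_abs_sub n
  rw [← h2] at h4
  zify
  linarith

theorem IsTree.three_mul_sum_dist_eq_iff (hG : G.IsTree) {n : ℕ} (hn : Fintype.card V = n) :
    3 * ∑ a, ∑ b, G.dist a b + n = n ^ 3 ↔ Nonempty (G ≃g pathGraph n) := by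
  subst hn
  refine ⟨fun h => ?_, fun ⟨e⟩ => le_antisymm hG.connected.three_mul_sum_dist_le.1
    (hG.connected.le_three_mul_sum_dist_of_iso e)⟩
  obtain ⟨v, hv⟩ := hG.connected.three_mul_sum_dist_le.2 h
  exact hG.nonempty_iso_pathGraph rfl fun k hk =>
    hG.connected.exists_dist_eq_of_two_mul_sum_dist_eq hv hk

/-! ### Stars minimize the total distance of a tree -/

section Star

variable [DecidableEq V] [DecidableRel G.Adj]

omit [Fintype V] in
lemma Connected.two_le_dist_add (hG : G.Connected) (a b : V) :
    2 ≤ G.dist a b + (if G.Adj a b then 1 else 0) + (if a = b then 2 else 0) := by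
  by_cases h : a = b
  · simp [h]
  · by_cases h' : G.Adj a b
    · simp [h, h', dist_eq_one_iff_adj.mpr h']
    · have := hG.one_lt_dist_of_ne_of_not_adj h h'
      simp [h, h']
      omega

omit [Fintype V] in
lemma Connected.two_eq_dist_add_iff (hG : G.Connected) (a b : V) :
    2 = G.dist a b + (if G.Adj a b then 1 else 0) + (if a = b then 2 else 0) ↔
      G.dist a b ≤ 2 := by
  by_cases h : a = b
  · simp [h]
  · by_cases h' : G.Adj a b
    · simp [h, h', dist_eq_one_iff_adj.mpr h']
    · have := hG.one_lt_dist_of_ne_of_not_adj h h'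
      simp [h, h']
      omega

omit [DecidableEq V] in
lemma IsTree.sum_sum_ite_adj_add_two (hG : G.IsTree) :
    ∑ a, ∑ b, (if G.Adj a b then 1 else 0) + 2 = 2 * Fintype.card V := by
  classical
  have h := G.sum_degrees_eq_twice_card_edges
  have h' := hG.card_edgeFinset
  have (a : V) : ∑ b, (if G.Adj a b then 1 else 0) = G.degree a := by
    rw [← Finset.card_filter, ← G.card_neighborFinset_eq_degree, G.neighborFinset_eq_filter]
  simp_rw [this, h]
  omega

/-- The bound compares the total distance with what it would be if all non-adjacent vertices had
distance `2`. -/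
theorem IsTree.two_mul_sq_le_sum_dist (hG : G.IsTree) :
    2 * Fintype.card V ^ 2 + 2 ≤ ∑ a, ∑ b, G.dist a b + 4 * Fintype.card V ∧
      (2 * Fintype.card V ^ 2 + 2 = ∑ a, ∑ b, G.dist a b + 4 * Fintype.card V ↔
        ∀ a b, G.dist a b ≤ 2) := by
  have h1 : ∑ a : V, ∑ b : V, 2 = 2 * Fintype.card V ^ 2 := by simp; ring
  have h2 : ∑ a : V, ∑ b : V, (if a = b then 2 else 0) = 2 * Fintype.card V := by simp; ring
  have h3 := hG.sum_sum_ite_adj_add_two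
  have h4 : ∑ a, ∑ b, (G.dist a b + (if G.Adj a b then 1 else 0) + (if a = b then 2 else 0)) + 2 =
      ∑ a, ∑ b, G.dist a b + 4 * Fintype.card V := by
    simp only [Finset.sum_add_distrib]
    omega
  have h5 (a b : V) := hG.connected.two_le_dist_add a b
  rw [← h4, ← h1]
  refine ⟨Nat.add_le_add_right
    (Finset.sum_le_sum fun a _ => Finset.sum_le_sum fun b _ => h5 a b) 2, ?_⟩
  rw [Nat.add_right_cancel_iff, Finset.sum_eq_sum_iff_of_le
    (fun a _ => Finset.sum_le_sum fun b _ => h5 a b)]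
  simp only [Finset.mem_univ, true_imp_iff]
  refine forall_congr' fun a => ?_
  rw [Finset.sum_eq_sum_iff_of_le (fun b _ => h5 a b)]
  simp only [Finset.mem_univ, true_imp_iff]
  exact forall_congr' fun b => hG.connected.two_eq_dist_add_iff a b

end Star

/-- A vertex `r` with two neighbours is the centre: a vertex at distance `2` from `r` would be at
distance `3` from one of those neighbours. -/
lemma IsTree.exists_eq_starGraph (hG : G.IsTree) (hV : 3 ≤ Fintype.card V)
    (h : ∀ a b, G.dist a b ≤ 2) : ∃ r, G = starGraph r := by
  classical
  obtain ⟨r, a, b, hab, hra, hrb⟩ : ∃ r a b, a ≠ b ∧ G.Adj r a ∧ G.Adj r b := by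
    by_contra! hcon
    have h1 : ∀ v, G.degree v ≤ 1 := fun v => by
      rw [← G.card_neighborFinset_eq_degree, Finset.card_le_one]
      intro a ha b hb
      by_contra hne
      exact hcon v a b hne (by simpa using ha) (by simpa using hb)
    have h2 := G.sum_degrees_eq_twice_card_edges
    have h3 := hG.card_edgeFinset
    have h4 : ∑ v, G.degree v ≤ ∑ v : V, 1 := Finset.sum_le_sum fun v _ => h1 v
    simp at h4
    omega
  have huniv (w : V) (hw : r ≠ w) : G.Adj r w := by
    by_contra hnadj
    have hrw : G.dist w r = 2 := le_antisymm (h w r)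
      (hG.connected.one_lt_dist_of_ne_of_not_adj hw.symm fun h' => hnadj h'.symm)
    have closer {c : V} (hc : G.Adj r c) : G.dist w r = G.dist w c + 1 := by
      have := h w c
      rcases hG.dist_eq_dist_add_one_of_adj w hc with h' | h' <;> omega
    exact hab (hG.eq_of_adj_of_dist_eq_add_one hra (closer hra) hrb (closer hrb))
  refine ⟨r, ?_⟩
  ext x y
  rw [starGraph_adj]
  constructor
  · intro hxy
    refine ⟨hxy.ne, ?_⟩
    by_contra! hne
    apply hG.dist_ne_of_adj r hxy
    rw [dist_eq_one_iff_adj.mpr (huniv x hne.1.symm), dist_eq_one_iff_adj.mpr (huniv y hne.2.symm)]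
  · rintro ⟨hne, rfl | rfl⟩
    · exact huniv y hne
    · exact (huniv x hne.symm).symm

omit [Fintype V] in
lemma dist_starGraph_le_two (r a b : V) : (starGraph r).dist a b ≤ 2 := by
  have h1 (x : V) : (starGraph r).dist r x ≤ 1 := by
    by_cases h : r = x
    · simp [h]
    · exact (dist_eq_one_iff_adj.mpr (starGraph_center_adj h)).le
  have h2 : (starGraph r).dist a b ≤ (starGraph r).dist a r + (starGraph r).dist r b :=
    (connected_starGraph r).dist_triangle
  have h3 := h1 a
  have h4 := h1 b
  rw [dist_comm] at h3
  omega

theorem IsTree.two_mul_sq_eq_sum_dist_iff (hG : G.IsTree) (hV : 3 ≤ Fintype.card V) :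
    2 * Fintype.card V ^ 2 + 2 = ∑ a, ∑ b, G.dist a b + 4 * Fintype.card V ↔
      ∃ r, G = starGraph r := by
  classical
  rw [hG.two_mul_sq_le_sum_dist.2]
  refine ⟨hG.exists_eq_starGraph hV, ?_⟩
  rintro ⟨r, rfl⟩
  exact dist_starGraph_le_two r

end SimpleGraph

/-! ### The Laplacian spectrum of a tree and its distance matrix -/

namespace Matrix.IsHermitian

variable {n : Type*} [Fintype n] [DecidableEq n] {A : Matrix n n ℝ}

lemma sum_eigenvectorBasis_mul (hA : A.IsHermitian) (i j : n) :
    ∑ u, hA.eigenvectorBasis i u * hA.eigenvectorBasis j u = if i = j then 1 else 0 := by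
  have := orthonormal_iff_ite.mp hA.eigenvectorBasis.orthonormal j i
  simpa [PiLp.inner_apply, eq_comm] using this

lemma sum_eigenvectorBasis_mul' (hA : A.IsHermitian) (u v : n) :
    ∑ i, hA.eigenvectorBasis i u * hA.eigenvectorBasis i v = if u = v then 1 else 0 := by
  have h := congrFun (congrFun (Unitary.coe_mul_star_self hA.eigenvectorUnitary) u) v
  simpa [Matrix.mul_apply, Matrix.one_apply, Matrix.star_eq_conjTranspose] using h

end Matrix.IsHermitian

namespace SimpleGraph

variable {V : Type*} [Fintype V] [DecidableEq V] {G : SimpleGraph V} [DecidableRel G.Adj]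

/-- The distance from `u` grows by `1` along every edge at `v`, except along the one leading
towards `u`. In matrix form, `L D = (2 - deg) 1ᵀ - 2 I` for the distance matrix `D` of a tree. -/
lemma IsTree.lapMatrix_mulVec_dist (hG : G.IsTree) (u v : V) :
    (G.lapMatrix ℝ *ᵥ fun w => (G.dist u w : ℝ)) v = 2 - G.degree v - if u = v then 2 else 0 := by
  rw [lapMatrix_mulVec_apply]
  by_cases huv : u = v
  · subst huv
    have : ∑ w ∈ G.neighborFinset u, (G.dist u w : ℝ) = G.degree u := by
      rw [← G.card_neighborFinset_eq_degree, Finset.card_eq_sum_ones, Nat.cast_sum]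
      refine Finset.sum_congr rfl fun w hw => ?_
      rw [dist_eq_one_iff_adj.mpr (by simpa using hw)]
    simp [this]
  · obtain ⟨c, hc, hd⟩ := hG.connected.exists_adj_dist_eq_add_one huv
    have hw (w : V) (hw : w ∈ G.neighborFinset v) :
        (G.dist u w : ℝ) = (G.dist u v + 1) - if w = c then 2 else 0 := by
      have hvw : G.Adj v w := by simpa using hw
      split_ifs with hwc
      · subst hwc
        rw [hd]
        push_cast
        ring
      · rcases hG.dist_eq_dist_add_one_of_adj u hvw with h | h
        · exact absurd (hG.eq_of_adj_of_dist_eq_add_one hvw h hc hd) hwc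
        · rw [h]
          push_cast
          ring
    rw [Finset.sum_congr rfl hw, Finset.sum_sub_distrib, Finset.sum_ite_eq']
    simp [huv, hc]
    ring

/-- Eigenvectors for nonzero eigenvalues are orthogonal to the constants. -/
lemma sum_eigenvectorBasis_eq_zero {i : V}
    (hi : (G.isHermitian_lapMatrix (R := ℝ)).eigenvalues i ≠ 0) :
    ∑ u, (G.isHermitian_lapMatrix (R := ℝ)).eigenvectorBasis i u = 0 := by
  set hA := G.isHermitian_lapMatrix (R := ℝ)
  have h1 : (1 : V → ℝ) ⬝ᵥ (G.lapMatrix ℝ *ᵥ ⇑(hA.eigenvectorBasis i)) = 0 := by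
    rw [Matrix.dotProduct_mulVec, ← Matrix.mulVec_transpose, (G.isSymm_lapMatrix (R := ℝ)).eq]
    have : G.lapMatrix ℝ *ᵥ (1 : V → ℝ) = 0 := G.lapMatrix_mulVec_const_eq_zero
    rw [this, zero_dotProduct]
  rw [hA.mulVec_eigenvectorBasis, dotProduct_smul, smul_eq_mul] at h1
  simpa [dotProduct] using (mul_eq_zero.mp h1).resolve_left hi

lemma Connected.eigenvectorBasis_eq (hG : G.Connected) {i : V}
    (hi : (G.isHermitian_lapMatrix (R := ℝ)).eigenvalues i = 0) (u v : V) :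
    (G.isHermitian_lapMatrix (R := ℝ)).eigenvectorBasis i u =
      (G.isHermitian_lapMatrix (R := ℝ)).eigenvectorBasis i v := by
  refine (G.lapMatrix_mulVec_eq_zero_iff_forall_reachable).mp ?_ u v (hG u v)
  rw [Matrix.IsHermitian.mulVec_eigenvectorBasis, hi, zero_smul]

/-- The spectral projection onto the kernel of the Laplacian is the one onto the constants. -/
lemma Connected.sum_kernel_eigenvectorBasis_mul (hG : G.Connected) (u v : V) :
    ∑ i with (G.isHermitian_lapMatrix (R := ℝ)).eigenvalues i = 0,
      (G.isHermitian_lapMatrix (R := ℝ)).eigenvectorBasis i u *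
        (G.isHermitian_lapMatrix (R := ℝ)).eigenvectorBasis i v = (Fintype.card V : ℝ)⁻¹ := by
  set hA := G.isHermitian_lapMatrix (R := ℝ)
  have hne := hG.nonempty
  have h1 : ∑ i, hA.eigenvectorBasis i u * ∑ w, hA.eigenvectorBasis i w = 1 := by
    simp_rw [Finset.mul_sum]
    rw [Finset.sum_comm]
    simp_rw [hA.sum_eigenvectorBasis_mul']
    simp
  rw [← Finset.sum_filter_add_sum_filter_not _ (fun i => hA.eigenvalues i = 0)] at h1
  have h2 : ∑ i with ¬ hA.eigenvalues i = 0,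
      hA.eigenvectorBasis i u * ∑ w, hA.eigenvectorBasis i w = 0 :=
    Finset.sum_eq_zero fun i hi => by
      rw [sum_eigenvectorBasis_eq_zero (by simpa using hi), mul_zero]
  have h3 : ∑ i with hA.eigenvalues i = 0,
      hA.eigenvectorBasis i u * ∑ w, hA.eigenvectorBasis i w = Fintype.card V *
        ∑ i with hA.eigenvalues i = 0, hA.eigenvectorBasis i u * hA.eigenvectorBasis i v := by
    rw [Finset.mul_sum]
    refine Finset.sum_congr rfl fun i hi => ?_
    rw [Finset.sum_congr rfl fun w _ =>
      hG.eigenvectorBasis_eq (by simpa using hi) w v]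
    simp
    ring
  rw [h2, h3, add_zero] at h1
  exact eq_inv_of_mul_eq_one_right h1

lemma Connected.sum_eigenvectorBasis_mul_eq_centeringMatrix (hG : G.Connected) (u v : V) :
    ∑ i with (G.isHermitian_lapMatrix (R := ℝ)).eigenvalues i ≠ 0,
      (G.isHermitian_lapMatrix (R := ℝ)).eigenvectorBasis i u *
        (G.isHermitian_lapMatrix (R := ℝ)).eigenvectorBasis i v =
      ConsensusNetwork.centeringMatrix V u v := by
  have h1 := hG.sum_kernel_eigenvectorBasis_mul u v
  have h2 := (G.isHermitian_lapMatrix (R := ℝ)).sum_eigenvectorBasis_mul' u v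
  rw [← Finset.sum_filter_add_sum_filter_not _
    (fun i => (G.isHermitian_lapMatrix (R := ℝ)).eigenvalues i = 0), h1] at h2
  simp only [ConsensusNetwork.centeringMatrix, Matrix.sub_apply, Matrix.one_apply,
    Matrix.smul_apply, Matrix.of_apply, smul_eq_mul, mul_one]
  linarith

/-- On an eigenvector for `μ ≠ 0`, the quadratic form of the distance matrix takes the value
`-2 / μ`, because `L D` is `-2 I` up to a rank-one term that vanishes there. -/
lemma IsTree.eigenvalues_mul_sum_dist (hG : G.IsTree) {i : V}
    (hi : (G.isHermitian_lapMatrix (R := ℝ)).eigenvalues i ≠ 0) :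
    (G.isHermitian_lapMatrix (R := ℝ)).eigenvalues i *
      ∑ u, ∑ v, G.dist u v * ((G.isHermitian_lapMatrix (R := ℝ)).eigenvectorBasis i u *
        (G.isHermitian_lapMatrix (R := ℝ)).eigenvectorBasis i v) = -2 := by
  set hA := G.isHermitian_lapMatrix (R := ℝ)
  set x : V → ℝ := ⇑(hA.eigenvectorBasis i) with hx
  set K : ℝ := ∑ v, (2 - (G.degree v : ℝ)) * x v
  have h1 (u : V) : hA.eigenvalues i * ∑ v, G.dist u v * x v = K - 2 * x u := by
    have e1 : (fun w => (G.dist u w : ℝ)) ⬝ᵥ (G.lapMatrix ℝ *ᵥ x) =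
        (G.lapMatrix ℝ *ᵥ fun w => (G.dist u w : ℝ)) ⬝ᵥ x := by
      rw [Matrix.dotProduct_mulVec, ← Matrix.mulVec_transpose, (G.isSymm_lapMatrix (R := ℝ)).eq]
    rw [hA.mulVec_eigenvectorBasis, dotProduct_smul, smul_eq_mul] at e1
    refine e1.trans ?_
    simp only [dotProduct, hG.lapMatrix_mulVec_dist, sub_mul _ (ite _ _ _),
      Finset.sum_sub_distrib, ite_mul, zero_mul, Finset.sum_ite_eq, Finset.mem_univ, if_true, K]
  calc _ = ∑ u, x u * (hA.eigenvalues i * ∑ v, G.dist u v * x v) := by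
        rw [Finset.mul_sum]
        refine Finset.sum_congr rfl fun u _ => ?_
        simp only [Finset.mul_sum]
        exact Finset.sum_congr rfl fun v _ => by ring
    _ = K * ∑ u, x u - 2 * ∑ u, x u * x u := by
        rw [Finset.mul_sum, Finset.mul_sum, ← Finset.sum_sub_distrib]
        exact Finset.sum_congr rfl fun u _ => by rw [h1]; ring
    _ = -2 := by
        rw [hx, sum_eigenvectorBasis_eq_zero hi, hA.sum_eigenvectorBasis_mul]
        simp

/-- The distance matrix has trace `0`; evaluating the trace in an eigenbasis of the Laplacian
expresses the sum of the reciprocal eigenvalues through the total distance. -/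
theorem IsTree.rhoSS_eq (hG : G.IsTree) :
    ConsensusNetwork.rhoSS G = (∑ u, ∑ v, (G.dist u v : ℝ)) / (4 * Fintype.card V) := by
  unfold ConsensusNetwork.rhoSS
  set hA := G.isHermitian_lapMatrix (R := ℝ)
  let q : V → ℝ := fun i => ∑ u, ∑ v, G.dist u v *
    (hA.eigenvectorBasis i u * hA.eigenvectorBasis i v)
  have swap (s : Finset V) : ∑ i ∈ s, q i = ∑ u, ∑ v, G.dist u v *
      ∑ i ∈ s, hA.eigenvectorBasis i u * hA.eigenvectorBasis i v := by
    simp only [q, Finset.mul_sum]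
    rw [Finset.sum_comm]
    exact Finset.sum_congr rfl fun u _ => Finset.sum_comm
  have h1 : ∑ i, q i = 0 := by
    rw [swap]
    simp_rw [hA.sum_eigenvectorBasis_mul']
    simp
  have h2 : ∑ i with hA.eigenvalues i = 0, q i =
      (∑ u, ∑ v, (G.dist u v : ℝ)) / Fintype.card V := by
    rw [swap]
    have hker (u v : V) : ∑ i with hA.eigenvalues i = 0,
        hA.eigenvectorBasis i u * hA.eigenvectorBasis i v = (Fintype.card V : ℝ)⁻¹ :=
      hG.connected.sum_kernel_eigenvectorBasis_mul u v
    simp_rw [hker, ← Finset.sum_mul]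
    rfl
  have h3 : ∑ i with ¬ hA.eigenvalues i = 0, q i =
      -2 * ∑ i with hA.eigenvalues i ≠ 0, (hA.eigenvalues i)⁻¹ := by
    rw [Finset.mul_sum]
    refine Finset.sum_congr rfl fun i hi => ?_
    have hi : hA.eigenvalues i ≠ 0 := by simpa using hi
    have := hG.eigenvalues_mul_sum_dist hi
    rw [eq_mul_inv_iff_mul_eq₀ hi, mul_comm]
    exact this
  rw [← Finset.sum_filter_add_sum_filter_not _ (fun i => hA.eigenvalues i = 0), h2, h3] at h1
  have := hG.connected.nonempty
  have hn : (Fintype.card V : ℝ) ≠ 0 := Nat.cast_ne_zero.mpr Fintype.card_ne_zero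
  field_simp at h1 ⊢
  linarith

end SimpleGraph

/-! ### Second moments of integrals of a square-integrable process -/

section SecondMoment

variable {α Ω : Type*} [MeasurableSpace α] [MeasurableSpace Ω]

lemma sq_integral_le_measureReal_mul (ν : Measure α) [IsFiniteMeasure ν] {f : α → ℝ}
    (hf : MemLp f 2 ν) : (∫ a, f a ∂ν) ^ 2 ≤ ν.real Set.univ * ∫ a, f a ^ 2 ∂ν := by
  set m := ν.real Set.univ
  set I := ∫ a, f a ∂ν with hI
  rcases (measureReal_nonneg : 0 ≤ m).eq_or_lt with hm | hm
  · have hν : ν = 0 := by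
      rw [← Measure.measure_univ_eq_zero]
      exact (measureReal_eq_zero_iff).mp hm.symm
    have : I = 0 := by simp [hI, hν]
    rw [this, show m = 0 from hm.symm]
    simp
  · have h1 : 0 ≤ ∫ a, (m * f a - I) ^ 2 ∂ν := integral_nonneg fun a => sq_nonneg _
    have h2 : ∫ a, (m * f a - I) ^ 2 ∂ν =
        m ^ 2 * (∫ a, f a ^ 2 ∂ν) - 2 * m * I * I + m * I ^ 2 := by
      have e (a : α) : (m * f a - I) ^ 2 = m ^ 2 * f a ^ 2 - 2 * m * I * f a + I ^ 2 := by ring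
      have i1 := hf.integrable_sq.const_mul (m ^ 2)
      have i2 := (hf.integrable one_le_two).const_mul (2 * m * I)
      have i3 : Integrable (fun a => m ^ 2 * f a ^ 2 - 2 * m * I * f a) ν := i1.sub i2
      simp_rw [e]
      rw [integral_add i3 (integrable_const _), integral_sub i1 i2, integral_const_mul,
        integral_const_mul, integral_const, smul_eq_mul]
    rw [h2] at h1
    have h3 : 0 ≤ m * (m * (∫ a, f a ^ 2 ∂ν) - I ^ 2) := by linarith
    linarith [nonneg_of_mul_nonneg_right h3 hm]

variable {ν : Measure α} [IsFiniteMeasure ν] {P : Measure Ω} [IsFiniteMeasure P]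
  {X : α → Ω → ℝ}

/-- By Cauchy–Schwarz in `a` and Tonelli. -/
lemma memLp_two_integral_left (hX : MemLp (fun p : α × Ω => X p.1 p.2) 2 (ν.prod P)) :
    MemLp (fun ω => ∫ a, X a ω ∂ν) 2 P := by
  have hmeas : AEStronglyMeasurable (fun ω => ∫ a, X a ω ∂ν) P :=
    hX.aestronglyMeasurable.prod_swap.integral_prod_right'
  rw [memLp_two_iff_integrable_sq hmeas]
  have hsq := hX.integrable_sq
  refine (hsq.integral_prod_right.const_mul (ν.real Set.univ)).mono' (hmeas.pow 2) ?_
  filter_upwards [hsq.prod_left_ae,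
    hX.aestronglyMeasurable.prod_swap.prodMk_left] with ω h1 h2
  rw [Real.norm_of_nonneg (sq_nonneg _)]
  exact sq_integral_le_measureReal_mul ν ((memLp_two_iff_integrable_sq h2).mpr h1)

lemma integral_mul_integral_eq (hX : MemLp (fun p : α × Ω => X p.1 p.2) 2 (ν.prod P))
    {Y : Ω → ℝ} (hY : MemLp Y 2 P) :
    ∫ ω, Y ω * ∫ a, X a ω ∂ν ∂P = ∫ a, ∫ ω, Y ω * X a ω ∂P ∂ν := by
  have h : Integrable (Function.uncurry fun ω a => Y ω * X a ω) (P.prod ν) :=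
    ((hY.comp_snd ν).integrable_mul hX).swap
  rw [← integral_integral_swap h]
  simp_rw [integral_const_mul]

end SecondMoment

/-! ### Variation of constants and integrals of the exponential kernel -/

section VariationOfConstants

lemma hasDerivAt_exp_neg_mul_sub (c t s : ℝ) :
    HasDerivAt (fun s => Real.exp (-(c * (t - s)))) (c * Real.exp (-(c * (t - s)))) s := by
  have h : HasDerivAt (fun s => -(c * (t - s))) c s := by
    simpa using (((hasDerivAt_id s).const_sub t).const_mul c).fun_neg
  simpa [mul_comm] using h.exp

lemma integral_exp_neg_mul_sub (c t a b : ℝ) :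
    c * ∫ s in a..b, Real.exp (-(c * (t - s))) =
      Real.exp (-(c * (t - b))) - Real.exp (-(c * (t - a))) := by
  rw [← intervalIntegral.integral_const_mul]
  refine intervalIntegral.integral_eq_sub_of_hasDerivAt
    (fun s _ => hasDerivAt_exp_neg_mul_sub c t s) ?_
  exact (by fun_prop : Continuous _).intervalIntegrable _ _

/-- Variation of constants for the integrated equation `f t = a - c ∫₀ᵗ f + b t`. Neither `f` nor
`b` needs to be continuous; the primitive of `f` is absolutely continuous, which suffices for the
integration by parts. -/
lemma eq_of_integral_equation {c a t : ℝ} {f b : ℝ → ℝ} (ht : 0 ≤ t)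
    (hf : IntervalIntegrable f volume 0 t)
    (h : ∀ s, 0 ≤ s → s ≤ t → f s = a - c * (∫ r in (0 : ℝ)..s, f r) + b s) :
    f t = Real.exp (-(c * t)) * a +
      (b t - c * ∫ s in (0 : ℝ)..t, Real.exp (-(c * (t - s))) * b s) := by
  set E : ℝ → ℝ := fun s => Real.exp (-(c * (t - s))) with hE
  set F : ℝ → ℝ := fun s => ∫ r in (0 : ℝ)..s, f r with hF
  have hEc : Continuous E := by fun_prop
  have hEac : AbsolutelyContinuousOnInterval E 0 t :=
    ContDiffOn.absolutelyContinuousOnInterval (ContDiff.contDiffOn (by fun_prop))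
  have hFac : AbsolutelyContinuousOnInterval F 0 t :=
    hf.absolutelyContinuousOnInterval_intervalIntegral Set.left_mem_uIcc
  have h1 : ∫ s in (0 : ℝ)..t, deriv E s * F s + E s * deriv F s = F t := by
    rw [hEac.integral_deriv_mul_eq_sub hFac]
    simp [hE, hF]
  have hb : IntervalIntegrable (fun s => E s * b s) volume 0 t := by
    have h2 : IntervalIntegrable (fun s => E s * (f s - a + c * F s)) volume 0 t := by
      refine IntervalIntegrable.continuousOn_mul ?_ hEc.continuousOn
      refine (hf.sub intervalIntegrable_const).add ?_
      exact (hFac.continuousOn.intervalIntegrable).const_mul c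
    refine h2.congr fun s hs => ?_
    rw [Set.uIoc_of_le ht] at hs
    rw [h s hs.1.le hs.2]
    ring
  have h2 : ∫ s in (0 : ℝ)..t, deriv E s * F s + E s * deriv F s =
      ∫ s in (0 : ℝ)..t, (a * E s + E s * b s) := by
    refine intervalIntegral.integral_congr_ae ?_
    filter_upwards [hf.ae_hasDerivAt_integral] with s hs hst
    have hd := hs (Set.uIoc_subset_uIcc hst) 0 Set.left_mem_uIcc
    rw [Set.uIoc_of_le ht] at hst
    rw [(hasDerivAt_exp_neg_mul_sub c t s).deriv, hd.deriv, h s hst.1.le hst.2]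
    simp only [hE, hF]
    ring
  rw [h1, intervalIntegral.integral_add (hEc.intervalIntegrable _ _ |>.const_mul a) hb,
    intervalIntegral.integral_const_mul] at h2
  have h3 : c * ∫ s in (0 : ℝ)..t, E s = 1 - Real.exp (-(c * t)) := by
    simpa using integral_exp_neg_mul_sub c t 0 t
  have h4 : c * F t = a * (1 - Real.exp (-(c * t))) + c * ∫ s in (0 : ℝ)..t, E s * b s := by
    rw [h2, ← h3]
    ring
  rw [h t ht le_rfl, h4]
  ring

/-- The covariance of `B s` with the stochastic convolution at time `t`, when `B` has covariance
`min`. -/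
lemma integral_exp_mul_min {c s t : ℝ} (hc : c ≠ 0) (hs : 0 ≤ s) (hst : s ≤ t) :
    s - c * (∫ r in (0 : ℝ)..t, Real.exp (-(c * (t - r))) * min s r) =
      (Real.exp (-(c * (t - s))) - Real.exp (-(c * t))) / c := by
  have hcont : Continuous fun r => Real.exp (-(c * (t - r))) * min s r := by fun_prop
  rw [← intervalIntegral.integral_add_adjacent_intervals (hcont.intervalIntegrable 0 s)
    (hcont.intervalIntegrable s t)]
  have h1 : ∫ r in (0 : ℝ)..s, Real.exp (-(c * (t - r))) * min s r =
      Real.exp (-(c * (t - s))) * (s / c - 1 / c ^ 2) + Real.exp (-(c * t)) * (1 / c ^ 2) := by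
    have h2 : ∫ r in (0 : ℝ)..s, Real.exp (-(c * (t - r))) * min s r =
        ∫ r in (0 : ℝ)..s, Real.exp (-(c * (t - r))) * r := by
      refine intervalIntegral.integral_congr fun r hr => ?_
      rw [Set.uIcc_of_le hs] at hr
      simp only [min_eq_right hr.2]
    rw [h2, intervalIntegral.integral_eq_sub_of_hasDerivAt
      (f := fun r => Real.exp (-(c * (t - r))) * (r / c - 1 / c ^ 2))]
    · simp
    · intro r _
      convert! (hasDerivAt_exp_neg_mul_sub c t r).mul
        (((hasDerivAt_id r).div_const c).sub_const (1 / c ^ 2)) using 1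
      simp only [id]
      field_simp
      ring
    · exact (by fun_prop : Continuous _).intervalIntegrable _ _
  have h3 : ∫ r in s..t, Real.exp (-(c * (t - r))) * min s r =
      s * ∫ r in s..t, Real.exp (-(c * (t - r))) := by
    rw [← intervalIntegral.integral_const_mul]
    refine intervalIntegral.integral_congr fun r hr => ?_
    rw [Set.uIcc_of_le hst] at hr
    simp only [min_eq_left hr.1, mul_comm]
  have h4 := integral_exp_neg_mul_sub c t s t
  simp only [sub_self, mul_zero, neg_zero, Real.exp_zero] at h4
  rw [h1, h3, mul_add, mul_left_comm c s, h4]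
  field_simp
  ring

lemma integral_exp_mul_exp_sub {c t : ℝ} (hc : c ≠ 0) :
    c * (∫ s in (0 : ℝ)..t, Real.exp (-(c * (t - s))) *
        ((Real.exp (-(c * (t - s))) - Real.exp (-(c * t))) / c)) =
      (1 - Real.exp (-(c * t))) ^ 2 / (2 * c) := by
  rw [intervalIntegral.integral_eq_sub_of_hasDerivAt
    (f := fun s => (Real.exp (-(c * (t - s))) - Real.exp (-(c * t))) ^ 2 / (2 * c ^ 2))]
  · simp
    field_simp
  · intro s _
    convert! (((hasDerivAt_exp_neg_mul_sub c t s).sub_const (Real.exp (-(c * t)))).pow 2).div_const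
      (2 * c ^ 2) using 1
    field_simp
    simp
    ring
  · exact (by fun_prop : Continuous _).intervalIntegrable _ _

end VariationOfConstants

/-! ### A single mode driven by white noise -/

section Mode

variable {Ω : Type*} [MeasurableSpace Ω] {P : Measure Ω} [IsProbabilityMeasure P]
  {B : ℝ → Ω → ℝ} {c : ℝ}

/-- The stochastic convolution `∫₀ᵗ e^{-c(t-s)} dB(s)`, integrated by parts so that it makes sense
path by path. -/
noncomputable def stochasticConvolution (c : ℝ) (B : ℝ → Ω → ℝ) (t : ℝ) (ω : Ω) : ℝ :=
  B t ω - c * ∫ s in (0 : ℝ)..t, Real.exp (-(c * (t - s))) * B s ω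

lemma memLp_two_exp_mul (hmeas : Measurable fun p : ℝ × Ω => B p.1 p.2)
    (hL2 : ∀ t, 0 ≤ t → MemLp (B t) 2 P)
    (hcov : ∀ s t, 0 ≤ s → 0 ≤ t → ∫ ω, B s ω * B t ω ∂P = min s t) (c t : ℝ) :
    MemLp (fun p : ℝ × Ω => Real.exp (-(c * (t - p.1))) * B p.1 p.2) 2
      ((volume.restrict (Set.Ioc 0 t)).prod P) := by
  have hm : Measurable fun p : ℝ × Ω => Real.exp (-(c * (t - p.1))) * B p.1 p.2 := by fun_prop
  rw [memLp_two_iff_integrable_sq hm.aestronglyMeasurable,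
    integrable_prod_iff (hm.pow_const 2).aestronglyMeasurable]
  constructor
  · filter_upwards [ae_restrict_mem measurableSet_Ioc] with s hs
    exact ((hL2 s hs.1.le).const_mul _).integrable_sq
  · have h1 : IntegrableOn (fun s => Real.exp (-(c * (t - s))) ^ 2 * s) (Set.Ioc 0 t) :=
      (Continuous.integrableOn_Icc (by fun_prop)).mono_set Set.Ioc_subset_Icc_self
    refine h1.congr ?_
    filter_upwards [ae_restrict_mem measurableSet_Ioc] with s hs
    have h2 := hcov s s hs.1.le hs.1.le
    simp_rw [Real.norm_of_nonneg (sq_nonneg _), mul_pow, integral_const_mul, pow_two (B _ _)]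
    rw [h2, min_self]

lemma memLp_stochasticConvolution (hmeas : Measurable fun p : ℝ × Ω => B p.1 p.2)
    (hL2 : ∀ t, 0 ≤ t → MemLp (B t) 2 P)
    (hcov : ∀ s t, 0 ≤ s → 0 ≤ t → ∫ ω, B s ω * B t ω ∂P = min s t) {t : ℝ} (ht : 0 ≤ t) :
    MemLp (stochasticConvolution c B t) 2 P := by
  have := memLp_two_integral_left (X := fun s ω => Real.exp (-(c * (t - s))) * B s ω)
    (memLp_two_exp_mul hmeas hL2 hcov c t)
  simp only [← intervalIntegral.integral_of_le ht] at this
  exact (hL2 t ht).sub (this.const_mul c)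

lemma integral_mul_stochasticConvolution (hmeas : Measurable fun p : ℝ × Ω => B p.1 p.2)
    (hL2 : ∀ t, 0 ≤ t → MemLp (B t) 2 P)
    (hcov : ∀ s t, 0 ≤ s → 0 ≤ t → ∫ ω, B s ω * B t ω ∂P = min s t) {t : ℝ} (ht : 0 ≤ t)
    {Y : Ω → ℝ} (hY : MemLp Y 2 P) :
    ∫ ω, Y ω * stochasticConvolution c B t ω ∂P = ∫ ω, Y ω * B t ω ∂P -
      c * ∫ s in (0 : ℝ)..t, Real.exp (-(c * (t - s))) * ∫ ω, Y ω * B s ω ∂P := by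
  have hX := memLp_two_exp_mul hmeas hL2 hcov c t
  have h1 := memLp_two_integral_left (X := fun s ω => Real.exp (-(c * (t - s))) * B s ω) hX
  have h2 := integral_mul_integral_eq (X := fun s ω => Real.exp (-(c * (t - s))) * B s ω) hX hY
  have h3 (ω : Ω) : Y ω * stochasticConvolution c B t ω = Y ω * B t ω -
      c * (Y ω * ∫ s in Set.Ioc 0 t, Real.exp (-(c * (t - s))) * B s ω) := by
    rw [stochasticConvolution, intervalIntegral.integral_of_le ht]
    ring
  have i1 : Integrable (fun ω => Y ω * B t ω) P := hY.integrable_mul (hL2 t ht)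
  have i2 : Integrable (fun ω => c * (Y ω * ∫ s in Set.Ioc 0 t,
      Real.exp (-(c * (t - s))) * B s ω)) P := (hY.integrable_mul h1).const_mul c
  simp_rw [h3]
  rw [integral_sub i1 i2,
    integral_const_mul, h2, intervalIntegral.integral_of_le ht]
  simp_rw [mul_left_comm (Y _), integral_const_mul]

/-- The Itô isometry for the exponential kernel: the variance is `∫₀ᵗ e^{-2c(t-s)} ds`. It follows
from the covariance of `B` alone, by expanding one factor of the square at a time. -/
lemma integral_stochasticConvolution_sq (hmeas : Measurable fun p : ℝ × Ω => B p.1 p.2)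
    (hL2 : ∀ t, 0 ≤ t → MemLp (B t) 2 P)
    (hcov : ∀ s t, 0 ≤ s → 0 ≤ t → ∫ ω, B s ω * B t ω ∂P = min s t) (hc : c ≠ 0)
    {t : ℝ} (ht : 0 ≤ t) :
    ∫ ω, stochasticConvolution c B t ω ^ 2 ∂P = (1 - Real.exp (-(c * t)) ^ 2) / (2 * c) := by
  have hη := memLp_stochasticConvolution (c := c) hmeas hL2 hcov ht
  have h1 (s : ℝ) (hs : 0 ≤ s) (hst : s ≤ t) :
      ∫ ω, stochasticConvolution c B t ω * B s ω ∂P =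
        (Real.exp (-(c * (t - s))) - Real.exp (-(c * t))) / c := by
    simp_rw [mul_comm _ (B s _)]
    rw [integral_mul_stochasticConvolution hmeas hL2 hcov ht (hL2 s hs), hcov s t hs ht,
      min_eq_left hst, ← integral_exp_mul_min hc hs hst]
    congr 2
    refine intervalIntegral.integral_congr fun r hr => ?_
    rw [Set.uIcc_of_le ht] at hr
    simp only [hcov s r hs hr.1]
  have h2 : ∫ s in (0 : ℝ)..t, Real.exp (-(c * (t - s))) *
      ∫ ω, stochasticConvolution c B t ω * B s ω ∂P = ∫ s in (0 : ℝ)..t,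
        Real.exp (-(c * (t - s))) * ((Real.exp (-(c * (t - s))) - Real.exp (-(c * t))) / c) := by
    refine intervalIntegral.integral_congr fun s hs => ?_
    rw [Set.uIcc_of_le ht] at hs
    simp only [h1 s hs.1 hs.2]
  simp_rw [pow_two (stochasticConvolution c B t _)]
  rw [integral_mul_stochasticConvolution hmeas hL2 hcov ht hη, h2, integral_exp_mul_exp_sub hc,
    h1 t ht le_rfl]
  simp
  field_simp
  ring

/-- An Ornstein–Uhlenbeck mode forgets its initial state, which may be correlated with the noise,
and its second moment tends to `1 / (2 c)`. -/
theorem tendsto_integral_mode_sq (hmeas : Measurable fun p : ℝ × Ω => B p.1 p.2)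
    (hL2 : ∀ t, 0 ≤ t → MemLp (B t) 2 P)
    (hcov : ∀ s t, 0 ≤ s → 0 ≤ t → ∫ ω, B s ω * B t ω ∂P = min s t) (hc : 0 < c)
    {z : ℝ → Ω → ℝ} (hz0 : MemLp (z 0) 2 P)
    (hint : ∀ᵐ ω ∂P, ∀ t, 0 ≤ t → IntervalIntegrable (fun s => z s ω) volume 0 t)
    (hz : ∀ᵐ ω ∂P, ∀ t, 0 ≤ t → z t ω = z 0 ω - c * (∫ s in (0 : ℝ)..t, z s ω) + B t ω) :
    (∀ t, 0 ≤ t → Integrable (fun ω => z t ω ^ 2) P) ∧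
      Tendsto (fun t => ∫ ω, z t ω ^ 2 ∂P) atTop (𝓝 (1 / (2 * c))) := by
  set η := stochasticConvolution c B with hηdef
  have hη (t : ℝ) (ht : 0 ≤ t) : MemLp (η t) 2 P := memLp_stochasticConvolution hmeas hL2 hcov ht
  have hsol (t : ℝ) (ht : 0 ≤ t) : (fun ω => z t ω ^ 2) =ᵐ[P] fun ω =>
      Real.exp (-(c * t)) ^ 2 * z 0 ω ^ 2 + 2 * Real.exp (-(c * t)) * (z 0 ω * η t ω) +
        η t ω ^ 2 := by
    filter_upwards [hint, hz] with ω h1 h2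
    rw [eq_of_integral_equation (f := fun s => z s ω) (b := fun s => B s ω) ht (h1 t ht)
      fun s hs _ => h2 s hs]
    simp only [hηdef, stochasticConvolution]
    ring
  have i1 (t : ℝ) : Integrable (fun ω => Real.exp (-(c * t)) ^ 2 * z 0 ω ^ 2) P :=
    hz0.integrable_sq.const_mul _
  have i2 (t : ℝ) (ht : 0 ≤ t) :
      Integrable (fun ω => 2 * Real.exp (-(c * t)) * (z 0 ω * η t ω)) P :=
    (hz0.integrable_mul (hη t ht)).const_mul _
  have i3 (t : ℝ) (ht : 0 ≤ t) : Integrable (fun ω => Real.exp (-(c * t)) ^ 2 * z 0 ω ^ 2 +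
      2 * Real.exp (-(c * t)) * (z 0 ω * η t ω)) P := (i1 t).add (i2 t ht)
  refine ⟨fun t ht => ((i3 t ht).add (hη t ht).integrable_sq).congr (hsol t ht).symm,
    ?_⟩
  have hval (t : ℝ) (ht : 0 ≤ t) : ∫ ω, z t ω ^ 2 ∂P =
      Real.exp (-(c * t)) ^ 2 * (∫ ω, z 0 ω ^ 2 ∂P) +
        2 * (Real.exp (-(c * t)) * ∫ ω, z 0 ω * η t ω ∂P) +
        (1 - Real.exp (-(c * t)) ^ 2) / (2 * c) := by
    rw [integral_congr_ae (hsol t ht), integral_add (i3 t ht) (hη t ht).integrable_sq,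
      integral_add (i1 t) (i2 t ht), integral_const_mul, integral_const_mul,
      integral_stochasticConvolution_sq hmeas hL2 hcov hc.ne' ht]
    ring
  have hexp : Tendsto (fun t => Real.exp (-(c * t))) atTop (𝓝 0) :=
    Real.tendsto_exp_neg_atTop_nhds_zero.comp (tendsto_id.const_mul_atTop hc)
  -- The correlation with the initial state stays bounded, by `2 |z η| ≤ z ^ 2 + η ^ 2`.
  have hcross : Tendsto (fun t => Real.exp (-(c * t)) * ∫ ω, z 0 ω * η t ω ∂P) atTop (𝓝 0) := by
    refine squeeze_zero_norm' (a := fun t => Real.exp (-(c * t)) *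
      ((∫ ω, z 0 ω ^ 2 ∂P) + 1 / (2 * c))) ?_ (by simpa using hexp.mul_const _)
    filter_upwards [eventually_ge_atTop 0] with t ht
    rw [norm_mul, Real.norm_of_nonneg (Real.exp_pos _).le]
    refine mul_le_mul_of_nonneg_left ?_ (Real.exp_pos _).le
    refine (norm_integral_le_of_norm_le (hz0.integrable_sq.add (hη t ht).integrable_sq)
      (ae_of_all P fun ω => ?_)).trans ?_
    · rw [Real.norm_eq_abs, abs_le]
      simp only [Pi.add_apply]
      constructor <;> nlinarith [sq_nonneg (z 0 ω + η t ω), sq_nonneg (z 0 ω - η t ω),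
        sq_nonneg (z 0 ω), sq_nonneg (η t ω)]
    · simp only [Pi.add_apply]
      rw [integral_add hz0.integrable_sq (hη t ht).integrable_sq,
        integral_stochasticConvolution_sq hmeas hL2 hcov hc.ne' ht]
      gcongr
      linarith [sq_nonneg (Real.exp (-(c * t)))]
  have hlim : Tendsto (fun t => Real.exp (-(c * t)) ^ 2 * (∫ ω, z 0 ω ^ 2 ∂P) +
        2 * (Real.exp (-(c * t)) * ∫ ω, z 0 ω * η t ω ∂P) +
        (1 - Real.exp (-(c * t)) ^ 2) / (2 * c)) atTop (𝓝 (1 / (2 * c))) := by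
    simpa using (((hexp.pow 2).mul_const _).add (hcross.const_mul 2)).add
      (((hexp.pow 2).const_sub 1).div_const (2 * c))
  refine hlim.congr' ?_
  filter_upwards [eventually_ge_atTop 0] with t ht
  exact (hval t ht).symm

end Mode

/-! ### Decomposition of the network into modes -/

namespace ConsensusNetwork

section Modes

variable {Ω V : Type*} [MeasurableSpace Ω] [Fintype V] {P : Measure Ω}
  {W x : ℝ → Ω → V → ℝ}

lemma IsIntegratedWhiteNoise.measurable_dotProduct [DecidableEq V]
    (hW : IsIntegratedWhiteNoise P W) (e : V → ℝ) :
    Measurable fun p : ℝ × Ω => e ⬝ᵥ W p.1 p.2 :=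
  Finset.measurable_sum _ fun i _ => (hW.measurable i).const_mul (e i)

lemma memLp_two_dotProduct {X : Ω → V → ℝ} (hX : ∀ i, MemLp (fun ω => X ω i) 2 P) (e : V → ℝ) :
    MemLp (fun ω => e ⬝ᵥ X ω) 2 P :=
  memLp_finsetSum _ fun i _ => (hX i).const_mul (e i)

lemma IsIntegratedWhiteNoise.integral_dotProduct_mul [DecidableEq V]
    (hW : IsIntegratedWhiteNoise P W) {e : V → ℝ} (he : e ⬝ᵥ e = 1) {s t : ℝ}
    (hs : 0 ≤ s) (ht : 0 ≤ t) :
    ∫ ω, (e ⬝ᵥ W s ω) * (e ⬝ᵥ W t ω) ∂P = min s t := by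
  have hi (i j : V) : Integrable (fun ω => e i * e j * (W s ω i * W t ω j)) P :=
    ((hW.memLp s hs i).integrable_mul (hW.memLp t ht j)).const_mul _
  have h1 (ω : Ω) : (e ⬝ᵥ W s ω) * (e ⬝ᵥ W t ω) = ∑ i, ∑ j, e i * e j * (W s ω i * W t ω j) := by
    simp only [dotProduct, Finset.sum_mul_sum]
    exact Finset.sum_congr rfl fun i _ => Finset.sum_congr rfl fun j _ => by ring
  simp_rw [h1]
  rw [integral_finsetSum _ fun i _ => integrable_finsetSum _ fun j _ => hi i j]
  simp_rw [integral_finsetSum Finset.univ fun j _ => hi _ j, integral_const_mul,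
    hW.covariance s t hs ht]
  simp only [mul_ite, mul_zero, Finset.sum_ite_eq, Finset.mem_univ, if_true, ← Finset.sum_mul]
  rw [dotProduct] at he
  rw [he, one_mul]

/-- The component of the state along an eigenvector `e` of a symmetric system matrix solves a
scalar equation of its own. -/
lemma IsStateTrajectory.dotProduct_eq {A : Matrix V V ℝ} (hA : A.IsSymm)
    (hx : IsStateTrajectory P A W x) {e : V → ℝ} {c : ℝ} (he : A *ᵥ e = c • e) :
    (∀ᵐ ω ∂P, ∀ t, 0 ≤ t → IntervalIntegrable (fun s => e ⬝ᵥ x s ω) volume 0 t) ∧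
      ∀ᵐ ω ∂P, ∀ t, 0 ≤ t → e ⬝ᵥ x t ω =
        e ⬝ᵥ x 0 ω - c * (∫ s in (0 : ℝ)..t, e ⬝ᵥ x s ω) + e ⬝ᵥ W t ω := by
  have hdot {ω : Ω} {t : ℝ} (h : ∀ i, IntervalIntegrable (fun s => x s ω i) volume 0 t)
      (a : V → ℝ) : IntervalIntegrable (fun s => a ⬝ᵥ x s ω) volume 0 t := by
    have := IntervalIntegrable.sum Finset.univ fun i _ => (h i).const_mul (a i)
    simpa only [dotProduct, Finset.sum_fn] using this
  refine ⟨?_, ?_⟩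
  · filter_upwards [hx.intervalIntegrable] with ω h t ht
    exact hdot (h t ht) e
  · filter_upwards [hx.intervalIntegrable, hx.integral_eq] with ω h1 h2 t ht
    have h3 : x t ω = x 0 ω - (fun i => ∫ s in (0 : ℝ)..t, (A *ᵥ x s ω) i) + W t ω :=
      funext fun i => h2 t ht i
    have h4 : e ⬝ᵥ (fun i => ∫ s in (0 : ℝ)..t, (A *ᵥ x s ω) i) =
        c * ∫ s in (0 : ℝ)..t, e ⬝ᵥ x s ω := by
      have h5 : ∀ i ∈ (Finset.univ : Finset V),
          IntervalIntegrable (fun s => e i * (A *ᵥ x s ω) i) volume 0 t :=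
        fun i _ => (hdot (h1 t ht) (A i)).const_mul (e i)
      simp only [dotProduct, ← intervalIntegral.integral_const_mul]
      rw [← intervalIntegral.integral_finsetSum h5]
      refine intervalIntegral.integral_congr fun s _ => ?_
      have h6 : e ⬝ᵥ (A *ᵥ x s ω) = c * (e ⬝ᵥ x s ω) := by
        rw [Matrix.dotProduct_mulVec, ← Matrix.mulVec_transpose, hA.eq, he, smul_dotProduct,
          smul_eq_mul]
      exact h6
    conv_lhs => rw [h3]
    rw [dotProduct_add, dotProduct_sub, h4]

end Modes

/-- Since `Cᵀ C` is the projection onto the nonzero modes, the output energy is the sum of the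
energies of these modes. -/
lemma output_dotProduct_self_eq {V U : Type*} [Fintype V] [DecidableEq V] [Fintype U]
    {G : SimpleGraph V} [DecidableRel G.Adj] (hG : G.Connected) {C : Matrix U V ℝ}
    (hC : Cᵀ * C = centeringMatrix V) (x : V → ℝ) :
    (C *ᵥ x) ⬝ᵥ (C *ᵥ x) =
      ∑ i with (G.isHermitian_lapMatrix (R := ℝ)).eigenvalues i ≠ 0,
        (⇑((G.isHermitian_lapMatrix (R := ℝ)).eigenvectorBasis i) ⬝ᵥ x) ^ 2 := by
  have h1 : (C *ᵥ x) ⬝ᵥ (C *ᵥ x) = x ⬝ᵥ (centeringMatrix V *ᵥ x) := by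
    rw [← hC, ← Matrix.mulVec_mulVec, Matrix.dotProduct_mulVec x, ← Matrix.mulVec_transpose,
      Matrix.transpose_transpose]
  rw [h1]
  simp only [dotProduct, Matrix.mulVec, ← hG.sum_eigenvectorBasis_mul_eq_centeringMatrix,
    Finset.sum_mul, Finset.mul_sum, pow_two]
  rw [Finset.sum_congr rfl fun u _ => Finset.sum_comm, Finset.sum_comm]
  exact Finset.sum_congr rfl fun i _ => Finset.sum_congr rfl fun u _ =>
    Finset.sum_congr rfl fun v _ => by ring

/-- Sum over the nonzero modes, each of which contributes `1 / (2 λ)` in the limit. -/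
theorem hasSteadyStateVariance_rhoSS {V Ω U : Type*} [Fintype V] [DecidableEq V]
    [MeasurableSpace Ω] [Fintype U] {G : SimpleGraph V} [DecidableRel G.Adj] (hG : G.Connected)
    {P : Measure Ω} [IsProbabilityMeasure P] {W x : ℝ → Ω → V → ℝ} {C : Matrix U V ℝ}
    (hW : IsIntegratedWhiteNoise P W) (hx : IsStateTrajectory P (G.lapMatrix ℝ) W x)
    (hC : Cᵀ * C = centeringMatrix V) :
    HasSteadyStateVariance P (fun t ω => C *ᵥ x t ω) (rhoSS G) := by
  set hA := G.isHermitian_lapMatrix (R := ℝ)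
  have hmode (i : V) (hi : i ∈ Finset.univ.filter fun i => hA.eigenvalues i ≠ 0) :
      (∀ t, 0 ≤ t → Integrable (fun ω => (⇑(hA.eigenvectorBasis i) ⬝ᵥ x t ω) ^ 2) P) ∧
      Tendsto (fun t => ∫ ω, (⇑(hA.eigenvectorBasis i) ⬝ᵥ x t ω) ^ 2 ∂P) atTop
        (𝓝 (1 / (2 * hA.eigenvalues i))) := by
    have hpos : 0 < hA.eigenvalues i :=
      ((G.posSemidef_lapMatrix ℝ).eigenvalues_nonneg i).lt_of_ne' (by simpa using hi)
    have hnorm : ⇑(hA.eigenvectorBasis i) ⬝ᵥ ⇑(hA.eigenvectorBasis i) = 1 :=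
      (hA.sum_eigenvectorBasis_mul i i).trans (if_pos rfl)
    obtain ⟨h1, h2⟩ := hx.dotProduct_eq (G.isSymm_lapMatrix (R := ℝ))
      (hA.mulVec_eigenvectorBasis i)
    exact tendsto_integral_mode_sq
      (B := fun t ω => ⇑(hA.eigenvectorBasis i) ⬝ᵥ W t ω)
      (z := fun t ω => ⇑(hA.eigenvectorBasis i) ⬝ᵥ x t ω)
      (hW.measurable_dotProduct _) (fun t ht => memLp_two_dotProduct (hW.memLp t ht) _)
      (fun s t hs ht => hW.integral_dotProduct_mul hnorm hs ht) hpos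
      (memLp_two_dotProduct hx.memLp_initial _) h1 h2
  have hrho : rhoSS G = ∑ i with hA.eigenvalues i ≠ 0, 1 / (2 * hA.eigenvalues i) := by
    rw [rhoSS, Finset.mul_sum]
    exact Finset.sum_congr rfl fun i _ => by rw [one_div_mul_eq_div, one_div, mul_inv]; ring
  unfold HasSteadyStateVariance
  simp_rw [output_dotProduct_self_eq hG hC]
  refine ⟨fun t ht => integrable_finsetSum _ fun i hi => (hmode i hi).1 t ht, ?_⟩
  rw [hrho]
  refine (tendsto_finsetSum _ fun i hi => (hmode i hi).2).congr' ?_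
  filter_upwards [eventually_ge_atTop 0] with t ht
  exact (integral_finsetSum _ fun i hi => (hmode i hi).1 t ht).symm

end ConsensusNetwork

theorem theorem4 {V : Type*} [Fintype V] [DecidableEq V] (n : ℕ) (hn : 5 ≤ n)
    (hcard : Fintype.card V = n) (T : SimpleGraph V) [DecidableRel T.Adj] (hT : T.IsTree) :
    -- the steady-state variance of the output exists and equals `rhoSS T`
    (∀ {Ω : Type*} [MeasurableSpace Ω] (P : Measure Ω) [IsProbabilityMeasure P]
        (W x : ℝ → Ω → V → ℝ) {U : Type*} [Fintype U] (C : Matrix U V ℝ),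
        ConsensusNetwork.IsIntegratedWhiteNoise P W →
        ConsensusNetwork.IsStateTrajectory P (T.lapMatrix ℝ) W x →
        Cᵀ * C = ConsensusNetwork.centeringMatrix V →
        ConsensusNetwork.HasSteadyStateVariance P (fun t ω => C *ᵥ x t ω)
          (ConsensusNetwork.rhoSS T)) ∧
    ((n : ℝ) - 1) ^ 2 / (2 * n) ≤ ConsensusNetwork.rhoSS T ∧
    ConsensusNetwork.rhoSS T ≤ ((n : ℝ) ^ 2 - 1) / 12 ∧
    (ConsensusNetwork.rhoSS T = ((n : ℝ) - 1) ^ 2 / (2 * n) ↔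
      ∃ r : V, T = SimpleGraph.starGraph r) ∧
    (ConsensusNetwork.rhoSS T = ((n : ℝ) ^ 2 - 1) / 12 ↔
      Nonempty (T ≃g SimpleGraph.pathGraph n)) := by
  refine ⟨fun P _ W x _ _ C hW hx hC =>
    ConsensusNetwork.hasSteadyStateVariance_rhoSS hT.connected hW hx hC, ?_⟩
  have hstar := hT.two_mul_sq_eq_sum_dist_iff (by omega)
  have hpath := hT.three_mul_sum_dist_eq_iff hcard
  have hlow := hT.two_mul_sq_le_sum_dist.1
  have hupp := hT.connected.three_mul_sum_dist_le.1
  have hrho := hT.rhoSS_eq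
  rw [hcard] at hstar hlow hupp hrho
  rw [← hstar, ← hpath, hrho, ← Nat.cast_inj (R := ℝ), ← Nat.cast_inj (R := ℝ) (m := _ + n)]
  have hn0 : (0 : ℝ) < n := by exact_mod_cast (by omega : 0 < n)
  rw [← Nat.cast_le (α := ℝ)] at hlow hupp
  push_cast at hlow hupp ⊢
  set S : ℝ := ∑ u, ∑ v, (T.dist u v : ℝ)
  have e1 : S / (4 * n) - ((n : ℝ) - 1) ^ 2 / (2 * n) =
      (S + 4 * n - (2 * n ^ 2 + 2)) / (4 * n) := by
    field_simp
    ring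
  have e2 : ((n : ℝ) ^ 2 - 1) / 12 - S / (4 * n) = (n ^ 3 - (3 * S + n)) / (12 * n) := by
    field_simp
    ring
  refine ⟨?_, ?_, ?_, ?_⟩
  · rw [← sub_nonneg, e1]
    exact div_nonneg (by linarith) (by positivity)
  · rw [← sub_nonneg, e2]
    exact div_nonneg (by linarith) (by positivity)
  · rw [← sub_eq_zero, e1, div_eq_zero_iff, or_iff_left (by positivity), sub_eq_zero, eq_comm]
  · rw [eq_comm, ← sub_eq_zero, e2, div_eq_zero_iff, or_iff_left (by positivity), sub_eq_zero,
      eq_comm]
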